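/- Let $M$ be a uniformly discrete metric space, i.e. there is $\theta>0$ with $d(x,y)>\theta$ for all $x\neq y$ in $M$. Then $M$ is Lip-lin injective. That is: for every metric space $N$, for every choice of base points $0_M\in M$ and $0_N\in N$, and for every injective Lipschitz map $f\colon M\to N$ with $f(0_M)=0_N$, the linearisation $\widehat f\colon \mathcal F(M)\to\mathcal F(N)$ is injective. Here $\mathrm{Lip}_0(M)$ is the space of Lipschitz functions $g\colon M\to\mathbb R$ with $g(0_M)=0$, normed by the best Lipschitz constant of $g$; $\delta_M(x)\in \mathrm{Lip}_0(M)^*$ is the evaluation $g\mapsto g(x)$; the Lipschitz-free space $\mathcal F(M)$ is the norm-closed linear span of $\{\delta_M(x):x\in M\}$ in $\mathrm{Lip}_0(M)^*$; $\mathcal F(N)$ is defined in the same way from $N$ and $0_N$; and $\widehat f$ is the unique bounded linear operator $\mathcal F(M)\to\mathcal F(N)$ with $\widehat f(\delta_M(x))=\delta_N(f(x))$ for all $x\in M$. -/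

import Mathlib

universe u v

noncomputable section

open scoped NNReal

namespace LipFree

/-- A metric space is uniformly discrete if there is `θ > 0` such that distinct points are
at distance greater than `θ`. -/
def UniformlyDiscrete (M : Type u) [MetricSpace M] : Prop :=
  ∃ θ : ℝ, 0 < θ ∧ ∀ x y : M, x ≠ y → θ < dist x y

/-- Membership in `Lip₀(M, N)`, for the base points `o` of `M` and `p` of `N`: Lipschitz maps
(with some constant) that send base point to base point. -/
def IsLip0 {M : Type u} {N : Type v} [MetricSpace M] [MetricSpace N] (o : M) (p : N)
    (f : M → N) : Prop :=
  (∃ K : ℝ≥0, LipschitzWith K f) ∧ f o = p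

section Lip0

variable {M : Type u} [MetricSpace M]

/-- The real Lipschitz functions vanishing at `o`, as a linear subspace of all functions. -/
def lip0Submodule (o : M) : Submodule ℝ (M → ℝ) where
  carrier := {f | IsLip0 o (0 : ℝ) f}
  zero_mem' := ⟨⟨0, LipschitzWith.const 0⟩, rfl⟩
  add_mem' := by
    rintro f g ⟨⟨K, hK⟩, hf⟩ ⟨⟨L, hL⟩, hg⟩
    exact ⟨⟨K + L, hK.add hL⟩, by simp [hf, hg]⟩
  smul_mem' := by
    rintro c f ⟨⟨K, hK⟩, hf⟩
    refine ⟨⟨‖c‖₊ * K, LipschitzWith.of_dist_le_mul fun x y => ?_⟩, by simp [hf]⟩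
    have h := mul_le_mul_of_nonneg_left (hK.dist_le_mul x y) (norm_nonneg c)
    simpa [dist_eq_norm, ← mul_sub, abs_mul, mul_assoc] using h

/-- The space `Lip₀(M)` of real Lipschitz functions vanishing at `o`. It is a type of its own, so
that its only topology is that of the Lipschitz norm below, not that of pointwise convergence. -/
structure Lip0 (o : M) where
  /-- the underlying function -/
  toFun : M → ℝ
  /-- it is Lipschitz and vanishes at `o` -/
  isLip0 : IsLip0 o (0 : ℝ) toFun

instance (o : M) : FunLike (Lip0 o) M ℝ where
  coe := Lip0.toFun
  coe_injective := by
    rintro ⟨f, hf⟩ ⟨g, hg⟩ h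
    cases h
    rfl

theorem Lip0.ext {o : M} {f g : Lip0 o} (h : ∀ x, f x = g x) : f = g :=
  DFunLike.ext f g h

/-- The vector space operations of `Lip₀(M)` are the pointwise ones. -/
def Lip0.equiv (o : M) : Lip0 o ≃ lip0Submodule o where
  toFun f := ⟨f.toFun, f.isLip0⟩
  invFun f := ⟨f.1, f.2⟩
  left_inv _ := rfl
  right_inv _ := rfl

instance (o : M) : AddCommGroup (Lip0 o) := (Lip0.equiv o).addCommGroup

instance (o : M) : Module ℝ (Lip0 o) := (Lip0.equiv o).module ℝ

theorem Lip0.add_apply {o : M} (f g : Lip0 o) (x : M) : (f + g) x = f x + g x := rfl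

theorem Lip0.smul_apply {o : M} (c : ℝ) (f : Lip0 o) (x : M) : (c • f) x = c * f x := rfl

theorem Lip0.zero_apply {o : M} (x : M) : (0 : Lip0 o) x = 0 := rfl

theorem Lip0.apply_base {o : M} (f : Lip0 o) : f o = 0 := f.isLip0.2

/-- The best Lipschitz constant `sup |f x - f y| / d(x, y)`. Pairs with `x = y` contribute
`0 / 0 = 0`. -/
instance (o : M) : Norm (Lip0 o) :=
  ⟨fun f => ⨆ q : M × M, |f q.1 - f q.2| / dist q.1 q.2⟩

theorem Lip0.norm_def {o : M} (f : Lip0 o) :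
    ‖f‖ = ⨆ q : M × M, |f q.1 - f q.2| / dist q.1 q.2 := rfl

theorem Lip0.bddAbove {o : M} (f : Lip0 o) :
    BddAbove (Set.range fun q : M × M => |f q.1 - f q.2| / dist q.1 q.2) := by
  obtain ⟨K, hK⟩ := f.isLip0.1
  refine ⟨K, ?_⟩
  rintro _ ⟨q, rfl⟩
  exact div_le_of_le_mul₀ dist_nonneg K.2 (hK.dist_le_mul q.1 q.2)

theorem Lip0.norm_nonneg' {o : M} (f : Lip0 o) : 0 ≤ ‖f‖ :=
  Real.iSup_nonneg fun _ => div_nonneg (abs_nonneg _) dist_nonneg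

theorem Lip0.abs_sub_le {o : M} (f : Lip0 o) (x y : M) : |f x - f y| ≤ ‖f‖ * dist x y := by
  rcases eq_or_ne x y with rfl | hxy
  · simp
  · exact (div_le_iff₀ (dist_pos.2 hxy)).1 (le_ciSup f.bddAbove (x, y))

theorem Lip0.norm_le {o : M} (f : Lip0 o) {C : ℝ} (hC : 0 ≤ C)
    (h : ∀ x y, |f x - f y| ≤ C * dist x y) : ‖f‖ ≤ C := by
  have : Nonempty M := ⟨o⟩
  exact ciSup_le fun q => div_le_of_le_mul₀ dist_nonneg hC (h q.1 q.2)

theorem Lip0.core (o : M) : NormedSpace.Core ℝ (Lip0 o) where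
  norm_nonneg := Lip0.norm_nonneg'
  norm_smul c f := by
    simp only [Lip0.norm_def, Lip0.smul_apply, ← mul_sub, abs_mul, mul_div_assoc,
      Real.norm_eq_abs]
    exact (Real.mul_iSup_of_nonneg (abs_nonneg c) _).symm
  norm_triangle f g := by
    refine Lip0.norm_le _ (add_nonneg f.norm_nonneg' g.norm_nonneg') fun x y => ?_
    have h1 := f.abs_sub_le x y
    have h2 := g.abs_sub_le x y
    have h3 := abs_add_le (f x - f y) (g x - g y)
    rw [Lip0.add_apply, Lip0.add_apply, add_sub_add_comm, add_mul]
    linarith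
  norm_eq_zero_iff f := by
    constructor
    · intro h
      refine Lip0.ext fun x => ?_
      have := f.abs_sub_le x o
      rw [h, zero_mul, f.apply_base, sub_zero] at this
      exact abs_eq_zero.1 (le_antisymm this (abs_nonneg _))
    · rintro rfl
      simp [Lip0.norm_def, Lip0.zero_apply]

instance (o : M) : NormedAddCommGroup (Lip0 o) := NormedAddCommGroup.ofCore (Lip0.core o)

instance (o : M) : NormedSpace ℝ (Lip0 o) := NormedSpace.ofCore (Lip0.core o)

/-- The evaluation functional `f ↦ f x` on `Lip₀(M)`. -/
def eval (o : M) (x : M) : StrongDual ℝ (Lip0 o) :=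
  LinearMap.mkContinuous
    { toFun := fun f => f x
      map_add' := fun f g => Lip0.add_apply f g x
      map_smul' := fun c f => Lip0.smul_apply c f x }
    (dist x o) fun f => by
      have h := f.abs_sub_le x o
      rw [f.apply_base, sub_zero, mul_comm] at h
      exact h

/-- The Lipschitz-free space `F(M)`: the norm-closed linear span, in the dual of `Lip₀(M)`,
of the evaluation functionals. -/
def FreeSpace (o : M) : Submodule ℝ (StrongDual ℝ (Lip0 o)) :=
  (Submodule.span ℝ (Set.range (eval o))).topologicalClosure

/-- The canonical map `δ : M → F(M)`. -/
def delta (o : M) (x : M) : FreeSpace o :=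
  ⟨eval o x, Submodule.le_topologicalClosure _ (Submodule.subset_span ⟨x, rfl⟩)⟩

end Lip0

section Linearisation

variable {M : Type u} {N : Type v} [MetricSpace M] [MetricSpace N]

/-- The composition operator `g ↦ g ∘ f` from `Lip₀(N)` to `Lip₀(M)`, for `f ∈ Lip₀(M, N)`. -/
def compOp {o : M} {p : N} {f : M → N} (hf : IsLip0 o p f) : Lip0 p →L[ℝ] Lip0 o :=
  LinearMap.mkContinuousOfExistsBound
    { toFun := fun g => ⟨fun x => g (f x), by
        obtain ⟨⟨K, hK⟩, h0⟩ := hf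
        obtain ⟨L, hL⟩ := g.isLip0.1
        exact ⟨⟨L * K, hL.comp hK⟩, (congrArg g h0).trans g.apply_base⟩⟩
      map_add' := fun _ _ => rfl
      map_smul' := fun _ _ => rfl } <| by
    obtain ⟨⟨K, hK⟩, h0⟩ := hf
    refine ⟨K, fun g => Lip0.norm_le _ (mul_nonneg K.2 g.norm_nonneg') fun x y => ?_⟩
    refine (g.abs_sub_le (f x) (f y)).trans ?_
    rw [mul_comm (K : ℝ), mul_assoc]
    exact mul_le_mul_of_nonneg_left (hK.dist_le_mul x y) g.norm_nonneg'

/-- The adjoint `μ ↦ (g ↦ μ (g ∘ f))` of the composition operator. -/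
def compOpDual {o : M} {p : N} {f : M → N} (hf : IsLip0 o p f) :
    StrongDual ℝ (Lip0 o) →L[ℝ] StrongDual ℝ (Lip0 p) :=
  ContinuousLinearMap.precomp ℝ (compOp hf)

theorem compOpDual_eval {o : M} {p : N} {f : M → N} (hf : IsLip0 o p f) (x : M) :
    compOpDual hf (eval o x) = eval p (f x) := rfl

theorem compOpDual_mem {o : M} {p : N} {f : M → N} (hf : IsLip0 o p f)
    (μ : FreeSpace o) : compOpDual hf μ ∈ FreeSpace p := by
  have h : FreeSpace o ≤ (FreeSpace p).comap (compOpDual hf).toLinearMap := by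
    refine Submodule.topologicalClosure_minimal _ (Submodule.span_le.2 ?_) ?_
    · rintro _ ⟨x, rfl⟩
      exact (delta p (f x)).2
    · exact (Submodule.isClosed_topologicalClosure _).preimage (compOpDual hf).continuous
  exact h μ.2

/-- The linearisation `f̂ : F(M) → F(N)` of `f ∈ Lip₀(M, N)`. By the two theorems below it is
the unique bounded linear operator with `f̂ (δ x) = δ (f x)` for all `x`. -/
def linearisation {o : M} {p : N} {f : M → N} (hf : IsLip0 o p f) :
    FreeSpace o →L[ℝ] FreeSpace p :=
  ((compOpDual hf).comp (FreeSpace o).subtypeL).codRestrict (FreeSpace p) (compOpDual_mem hf)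

theorem linearisation_delta {o : M} {p : N} {f : M → N} (hf : IsLip0 o p f) (x : M) :
    linearisation hf (delta o x) = delta p (f x) := rfl

theorem linearisation_unique {o : M} {p : N} {f : M → N} (hf : IsLip0 o p f)
    (T : FreeSpace o →L[ℝ] FreeSpace p) (hT : ∀ x, T (delta o x) = delta p (f x)) :
    T = linearisation hf := by
  have key : ∀ μ (hμ : μ ∈ FreeSpace o), T ⟨μ, hμ⟩ = linearisation hf ⟨μ, hμ⟩ := by
    have hd : Dense (Submodule.span ℝ (Set.range (delta o)) : Set (FreeSpace o)) := by
      rw [Subtype.dense_iff]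
      intro μ hμ
      have him : (Subtype.val '' (Submodule.span ℝ (Set.range (delta o)) : Set (FreeSpace o)))
          = (Submodule.span ℝ (Set.range (eval o)) : Set (StrongDual ℝ (Lip0 o))) := by
        have h := Submodule.map_span (FreeSpace o).subtype (Set.range (delta o))
        rw [← Set.range_comp] at h
        exact congrArg SetLike.coe h
      exact (congrArg closure him).symm ▸ hμ
    have he : Set.EqOn T (linearisation hf) (Set.range (delta o)) := by
      rintro _ ⟨x, rfl⟩
      rw [hT, linearisation_delta]
    have := ContinuousLinearMap.ext_on hd he
    intro μ hμ
    rw [this]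
  exact ContinuousLinearMap.ext fun μ => key μ.1 μ.2

end Linearisation

/-- `M` is Lip-lin injective if for every metric space `N`, all base points `o` of `M` and `p`
of `N`, and every injective `f ∈ Lip₀(M, N)`, the linearisation of `f` is injective. -/
def LipLinInjective (M : Type u) [MetricSpace M] : Prop :=
  ∀ (N : Type v) [MetricSpace N] (o : M) (p : N) (f : M → N) (hf : IsLip0 o p f),
    Function.Injective f → Function.Injective (linearisation hf)

end LipFree

end

namespace LipFree

open Filter Topology
open scoped NNReal

/-! ### Weak-star continuity of `FreeSpace` on bounded sets -/

section WeakStar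

variable {M : Type u} [MetricSpace M]

/-! Elements of the free space, being norm limits of combinations of evaluations, respect pointwise
limits of norm-bounded families (`FreeSpace.tendsto`). On a uniformly discrete space, a sup bound
already gives a Lipschitz bound.

If the linearisation kills `μ`, then `μ` kills every `g ∘ f`. Take for `g` ever steeper tents of
height one at `f a`. Their norms on `N` blow up, but their composites with `f` are bounded by one,
hence norm-bounded on `M`, and by injectivity they tend pointwise to the indicator of `a`. So `μ`
kills indicators of points (`FreeSpace.indicator_eq_zero`). Linearity and two further bounded
pointwise limits give `μ = 0` (`FreeSpace.eq_zero_of_indicator`). -/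

theorem Lip0.sub_apply {o : M} (f g : Lip0 o) (x : M) : (f - g) x = f x - g x := rfl

/-- Elements of the Lipschitz-free space send bounded pointwise null families to null families. -/
theorem FreeSpace.tendsto_zero {ι : Type*} {l : Filter ι} {o : M} {μ : StrongDual ℝ (Lip0 o)}
    (hμ : μ ∈ FreeSpace o) {u : ι → Lip0 o} {C : ℝ} (hC : ∀ i, ‖u i‖ ≤ C)
    (hu : ∀ x, Tendsto (fun i => u i x) l (𝓝 0)) :
    Tendsto (fun i => μ (u i)) l (𝓝 0) := by
  have hspan : ∀ ν ∈ Submodule.span ℝ (Set.range (eval o)),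
      Tendsto (fun i => ν (u i)) l (𝓝 0) := by
    intro ν hν
    induction hν using Submodule.span_induction with
    | mem ν h =>
      obtain ⟨x, rfl⟩ := h
      exact hu x
    | zero => exact tendsto_const_nhds
    | add ν₁ ν₂ _ _ h₁ h₂ => simpa using h₁.add h₂
    | smul c ν _ h => simpa using h.const_mul c
  rw [Metric.tendsto_nhds]
  intro ε hε
  -- Half of `ε` pays for replacing `μ` by `ν`. `|C| + 1` is a positive denominator whatever `C` is.
  have hδ : 0 < ε / (2 * (|C| + 1)) := by positivity
  obtain ⟨ν, hν, hd⟩ := Metric.mem_closure_iff.1 hμ _ hδ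
  filter_upwards [Metric.tendsto_nhds.1 (hspan ν hν) (ε / 2) (half_pos hε)] with i hi
  rw [dist_zero_right] at hi ⊢
  rw [dist_eq_norm] at hd
  have h₁ : ‖(μ - ν) (u i)‖ ≤ ε / (2 * (|C| + 1)) * (|C| + 1) :=
    ((μ - ν).le_opNorm (u i)).trans <| mul_le_mul hd.le
      ((hC i).trans ((le_abs_self C).trans (by linarith))) (norm_nonneg _) hδ.le
  have h₂ : ε / (2 * (|C| + 1)) * (|C| + 1) = ε / 2 := by
    have : |C| + 1 ≠ 0 := by positivity
    field_simp
  have h₃ : μ (u i) = (μ - ν) (u i) + ν (u i) := by simp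
  have h₄ := norm_add_le ((μ - ν) (u i)) (ν (u i))
  rw [h₃]
  linarith

/-- Elements of the Lipschitz-free space are continuous along bounded pointwise convergent
families. -/
theorem FreeSpace.tendsto {ι : Type*} {l : Filter ι} {o : M} {μ : StrongDual ℝ (Lip0 o)}
    (hμ : μ ∈ FreeSpace o) {u : ι → Lip0 o} {g : Lip0 o} {C : ℝ} (hC : ∀ i, ‖u i‖ ≤ C)
    (hu : ∀ x, Tendsto (fun i => u i x) l (𝓝 (g x))) :
    Tendsto (fun i => μ (u i)) l (𝓝 (μ g)) := by
  have h : Tendsto (fun i => μ (u i - g)) l (𝓝 0) := by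
    refine FreeSpace.tendsto_zero hμ (C := C + ‖g‖)
      (fun i => (norm_sub_le _ _).trans (by linarith [hC i])) fun x => ?_
    simpa [Lip0.sub_apply] using (hu x).sub_const (g x)
  simpa using h.add_const (μ g)

/-- Elements of the Lipschitz-free space that vanish on a bounded family vanish at its pointwise
limit. -/
theorem FreeSpace.apply_eq_zero {ι : Type*} {l : Filter ι} [l.NeBot] {o : M}
    {μ : StrongDual ℝ (Lip0 o)} (hμ : μ ∈ FreeSpace o) {u : ι → Lip0 o} {g : Lip0 o} {C : ℝ}
    (hC : ∀ i, ‖u i‖ ≤ C) (hu : ∀ x, Tendsto (fun i => u i x) l (𝓝 (g x)))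
    (h : ∀ i, μ (u i) = 0) : μ g = 0 :=
  tendsto_nhds_unique (FreeSpace.tendsto hμ hC hu) (by simp [h])

end WeakStar

/-! ### Reduction to indicators of points -/

section UniformlyDiscrete

variable {M : Type u} [MetricSpace M]

/-- The oscillation is at most `2 * C`, and distinct points are at least `θ` apart. -/
theorem abs_sub_le_of_bounded {θ : ℝ} (hθ : 0 < θ) (hM : ∀ x y : M, x ≠ y → θ < dist x y)
    {g : M → ℝ} {C : ℝ} (hC : ∀ x, |g x| ≤ C) (x y : M) :
    |g x - g y| ≤ 2 * C / θ * dist x y := by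
  rcases eq_or_ne x y with rfl | hxy
  · simp
  have hC0 : 0 ≤ C := (abs_nonneg _).trans (hC x)
  calc |g x - g y| ≤ |g x| + |g y| := abs_sub _ _
    _ ≤ 2 * C / θ * θ := by
      rw [div_mul_cancel₀ _ hθ.ne']
      linarith [hC x, hC y]
    _ ≤ 2 * C / θ * dist x y :=
      mul_le_mul_of_nonneg_left (hM x y hxy).le (by positivity)

/-- Bounded functions on a uniformly discrete space that vanish at the base point, as elements of
`Lip₀`. -/
def Lip0.ofBounded {o : M} {θ : ℝ} (hθ : 0 < θ) (hM : ∀ x y : M, x ≠ y → θ < dist x y)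
    (g : M → ℝ) (C : ℝ) (hC : ∀ x, |g x| ≤ C) (h0 : g o = 0) : Lip0 o where
  toFun := g
  isLip0 := by
    have hC0 : 0 ≤ C := (abs_nonneg _).trans (hC o)
    exact ⟨⟨⟨2 * C / θ, by positivity⟩,
      LipschitzWith.of_dist_le_mul fun x y => abs_sub_le_of_bounded hθ hM hC x y⟩, h0⟩

theorem Lip0.norm_le_of_bounded {o : M} {θ : ℝ} (hθ : 0 < θ)
    (hM : ∀ x y : M, x ≠ y → θ < dist x y) (g : Lip0 o) {C : ℝ} (hC : ∀ x, |g x| ≤ C) :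
    ‖g‖ ≤ 2 * C / θ := by
  have hC0 : 0 ≤ C := (abs_nonneg _).trans (hC o)
  exact g.norm_le (by positivity) (abs_sub_le_of_bounded hθ hM hC)

/-- Truncation of a function at height `n`. -/
def Lip0.truncate {o : M} (g : Lip0 o) (n : ℕ) : Lip0 o where
  toFun x := max (-n : ℝ) (min n (g x))
  isLip0 := by
    obtain ⟨K, hK⟩ := g.isLip0.1
    exact ⟨⟨K, (hK.const_min (n : ℝ)).const_max (-n : ℝ)⟩, by simp [g.apply_base]⟩

theorem Lip0.truncate_apply {o : M} (g : Lip0 o) (n : ℕ) (x : M) :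
    g.truncate n x = max (-n : ℝ) (min n (g x)) := rfl

theorem Lip0.abs_truncate_le {o : M} (g : Lip0 o) (n : ℕ) (x : M) : |g.truncate n x| ≤ n := by
  rw [truncate_apply, abs_le]
  exact ⟨le_max_left _ _, max_le (by linarith [n.cast_nonneg (α := ℝ)]) (min_le_left _ _)⟩

theorem Lip0.norm_truncate_le {o : M} (g : Lip0 o) (n : ℕ) : ‖g.truncate n‖ ≤ ‖g‖ := by
  have hg : LipschitzWith ⟨‖g‖, g.norm_nonneg'⟩ g :=
    LipschitzWith.of_dist_le_mul g.abs_sub_le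
  exact (g.truncate n).norm_le g.norm_nonneg'
    ((hg.const_min (n : ℝ)).const_max (-n : ℝ)).dist_le_mul

theorem Lip0.tendsto_truncate {o : M} (g : Lip0 o) (x : M) :
    Tendsto (fun n => g.truncate n x) atTop (𝓝 (g x)) := by
  obtain ⟨m, hm⟩ := exists_nat_ge |g x|
  refine tendsto_const_nhds.congr' ?_
  filter_upwards [eventually_ge_atTop m] with n hn
  have hmn : |g x| ≤ n := hm.trans (by exact_mod_cast hn)
  rw [truncate_apply, min_eq_right (abs_le.1 hmn).2, max_eq_right (abs_le.1 hmn).1]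

open Classical in
/-- Over a uniformly discrete space, an element of the Lipschitz-free space that vanishes on the
indicators of all points other than the base point is zero. -/
theorem FreeSpace.eq_zero_of_indicator {o : M} {θ : ℝ} (hθ : 0 < θ)
    (hM : ∀ x y : M, x ≠ y → θ < dist x y) {μ : StrongDual ℝ (Lip0 o)} (hμ : μ ∈ FreeSpace o)
    (h : ∀ a, a ≠ o → ∀ g : Lip0 o, (∀ x, g x = if x = a then 1 else 0) → μ g = 0) :
    μ = 0 := by
  have hfin : ∀ (s : Finset M) (g : Lip0 o), (∀ x ∉ s, g x = 0) → μ g = 0 := by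
    intro s
    induction s using Finset.induction_on with
    | empty =>
      intro g hg
      have : g = 0 := Lip0.ext fun x => hg x (by simp)
      simp [this]
    | insert a s _ ih =>
      intro g hg
      -- The indicator of the base point is not in `Lip0 o`, but `g` vanishes there anyway.
      rcases eq_or_ne a o with rfl | hao
      · refine ih g fun x hx => ?_
        rcases eq_or_ne x a with rfl | hxa
        · exact g.apply_base
        · exact hg x (by simp [hxa, hx])
      let e : Lip0 o := Lip0.ofBounded hθ hM (fun x => if x = a then 1 else 0) 1
        (fun x => by split_ifs <;> simp) (if_neg hao.symm)
      have he : ∀ x, e x = if x = a then 1 else 0 := fun _ => rfl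
      have hsub : μ (g - g a • e) = 0 := ih _ fun x hx => by
        rw [Lip0.sub_apply, Lip0.smul_apply, he]
        rcases eq_or_ne x a with rfl | hxa
        · simp
        · simp [hxa, hg x (by simp [hxa, hx])]
      simpa [h a hao e he] using hsub
  have hbdd : ∀ (g : Lip0 o) (C : ℝ), (∀ x, |g x| ≤ C) → μ g = 0 := by
    intro g C hC
    have hC0 : 0 ≤ C := (abs_nonneg _).trans (hC o)
    have hb : ∀ (s : Finset M) x, |if x ∈ s then g x else 0| ≤ C := fun s x => by
      split_ifs
      · exact hC x
      · simpa using hC0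
    -- Restrictions of `g` to finite sets share the sup bound `C`, hence a Lipschitz bound
    -- independent of the set.
    let u : Finset M → Lip0 o := fun s => Lip0.ofBounded hθ hM (fun x => if x ∈ s then g x else 0)
      C (hb s) (by simp [g.apply_base])
    have hu : ∀ s x, u s x = if x ∈ s then g x else 0 := fun _ _ => rfl
    refine FreeSpace.apply_eq_zero (l := atTop) hμ
      (fun s => (u s).norm_le_of_bounded hθ hM (hb s)) (fun x => ?_)
      fun s => hfin s (u s) fun x hx => by rw [hu, if_neg hx]
    refine tendsto_const_nhds.congr' ?_
    filter_upwards [eventually_ge_atTop {x}] with s hs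
    rw [hu, if_pos (hs (Finset.mem_singleton_self x))]
  ext g
  -- The sup bound `n` of the truncations grows, so the uniform bound must be `‖g‖`: truncation does
  -- not raise the Lipschitz constant.
  exact FreeSpace.apply_eq_zero hμ g.norm_truncate_le g.tendsto_truncate
    fun n => hbdd _ n (g.abs_truncate_le n)

end UniformlyDiscrete

/-! ### Tents on the target and recovery of indicators -/

section Bump

variable {N : Type v} [MetricSpace N]

/-- The tent function of slope `K` and height one at `q`, which vanishes at `p` if `K` is large. -/
def Lip0.tent (p q : N) (K : ℝ≥0) (hK : 1 ≤ K * dist p q) : Lip0 p where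
  toFun y := max 0 (1 - K * dist y q)
  isLip0 := by
    refine ⟨⟨K, LipschitzWith.const_max (LipschitzWith.of_dist_le_mul fun x y => ?_) 0⟩,
      max_eq_left (by linarith)⟩
    rw [Real.dist_eq, sub_sub_sub_cancel_left, ← mul_sub, abs_mul, NNReal.abs_eq, dist_comm x y]
    exact mul_le_mul_of_nonneg_left (abs_dist_sub_le y x q) K.2

theorem Lip0.tent_apply (p q : N) (K : ℝ≥0) (hK : 1 ≤ K * dist p q) (y : N) :
    Lip0.tent p q K hK y = max 0 (1 - K * dist y q) := rfl

theorem Lip0.abs_tent_le (p q : N) (K : ℝ≥0) (hK : 1 ≤ K * dist p q) (y : N) :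
    |Lip0.tent p q K hK y| ≤ 1 := by
  have h : 0 ≤ K * dist y q := mul_nonneg K.2 dist_nonneg
  rw [tent_apply, abs_of_nonneg (le_max_left _ _)]
  exact max_le zero_le_one (by linarith)

end Bump

theorem compOp_apply {M : Type u} {N : Type v} [MetricSpace M] [MetricSpace N] {o : M} {p : N}
    {f : M → N} (hf : IsLip0 o p f) (g : Lip0 p) (x : M) : compOp hf g x = g (f x) := rfl

open Classical in
theorem FreeSpace.indicator_eq_zero {M : Type u} {N : Type v} [MetricSpace M] [MetricSpace N]
    {θ : ℝ} (hθ : 0 < θ) (hM : ∀ x y : M, x ≠ y → θ < dist x y) {o : M} {p : N} {f : M → N}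
    (hf : IsLip0 o p f) (hinj : Function.Injective f) {μ : StrongDual ℝ (Lip0 o)}
    (hμ : μ ∈ FreeSpace o) (h : compOpDual hf μ = 0) {a : M} (ha : a ≠ o) (g : Lip0 o)
    (hg : ∀ x, g x = if x = a then 1 else 0) : μ g = 0 := by
  have hd : 0 < dist p (f a) := dist_pos.2 fun hpa => ha (hinj (hf.2.trans hpa)).symm
  -- The summand `n` makes the slopes unbounded; the inverse distance makes every tent vanish at
  -- `p`.
  let K : ℕ → ℝ≥0 := fun n => n + ⟨(dist p (f a))⁻¹, (inv_pos.2 hd).le⟩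
  have hKn : ∀ n, (K n : ℝ) = n + (dist p (f a))⁻¹ := fun _ => rfl
  have hK : ∀ n, 1 ≤ (K n : ℝ) * dist p (f a) := fun n => by
    rw [hKn, add_mul, inv_mul_cancel₀ hd.ne']
    have : 0 ≤ (n : ℝ) * dist p (f a) := by positivity
    linarith
  refine FreeSpace.apply_eq_zero (l := atTop) hμ
    (u := fun n => compOp hf (Lip0.tent p (f a) (K n) (hK n)))
    (fun n => Lip0.norm_le_of_bounded hθ hM _ fun x => Lip0.abs_tent_le p (f a) (K n) (hK n) (f x))
    (fun x => ?_) fun n => DFunLike.congr_fun h (Lip0.tent p (f a) (K n) (hK n))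
  simp only [compOp_apply, Lip0.tent_apply, hg]
  split_ifs with hxa
  · simp [hxa]
  have hx : 0 < dist (f x) (f a) := dist_pos.2 (hinj.ne hxa)
  -- Once the slope reaches this inverse distance, the tent is zero at `f x`.
  obtain ⟨m, hm⟩ := exists_nat_ge (dist (f x) (f a))⁻¹
  refine tendsto_const_nhds.congr' ?_
  filter_upwards [eventually_ge_atTop m] with n hn
  have hmn : (dist (f x) (f a))⁻¹ ≤ K n := by
    have : (m : ℝ) ≤ n := by exact_mod_cast hn
    rw [hKn]
    linarith [inv_pos.2 hd]
  have := mul_le_mul_of_nonneg_right hmn hx.le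
  rw [inv_mul_cancel₀ hx.ne'] at this
  exact (max_eq_left (by linarith)).symm

end LipFree

theorem mainTheorem3 (M : Type u) [MetricSpace M] (hM : LipFree.UniformlyDiscrete M) :
    LipFree.LipLinInjective.{u, v} M := by
  obtain ⟨θ, hθ, hM⟩ := hM
  intro N _ o p f hf hinj
  rw [injective_iff_map_eq_zero]
  intro μ h
  exact Subtype.ext <| LipFree.FreeSpace.eq_zero_of_indicator hθ hM μ.2 fun _ ha =>
    LipFree.FreeSpace.indicator_eq_zero hθ hM hf hinj μ.2 (congrArg Subtype.val h) ha
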